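/- For $n\ge 1$ let $\Omega_n$ be the spectral ball, i.e. the set of complex $n\times n$ matrices all of whose eigenvalues lie in the open unit disc $\mathbb D$. For a domain $D\subset\mathbb C^m$, $z,w\in D$ and $X\in\mathbb C^m$ let $$l_D(z,w)=\inf\{|\alpha|:\alpha\in\mathbb D,\ \exists\varphi\in\mathcal O(\mathbb D,D),\ \varphi(0)=z,\ \varphi(\alpha)=w\}$$ be the Lempert function, let $$\kappa_D(z;X)=\inf\{|\alpha|:\alpha\in\mathbb C,\ \exists\varphi\in\mathcal O(\mathbb D,D),\ \varphi(0)=z,\ \alpha\varphi'(0)=X\}$$ be the Kobayashi pseudometric, and let $$\widetilde{\mathcal D}l_D(z;X)=\limsup_{t\to0,\ t\in\mathbb C\setminus\{0\}}\frac{l_D(z,z+tX)}{|t|}$$ be the weak derivative of the Lempert function. Put $\omega=e^{2\pi i/3}$ and $$A=\begin{pmatrix}0&0&0\\0&0&1\\0&0&0\end{pmatrix},\qquad B=\begin{pmatrix}1&0&0\\0&\omega&0\\0&0&\omega^2\end{pmatrix}.$$ The spectral ball $\Omega_3$ is a pseudoconvex domain in the space $\mathbb C^9$ of complex $3\times3$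 matrices, and $$\infty>\kappa_{\Omega_3}(A;B)>0=\widetilde{\mathcal D}l_{\Omega_3}(A;B).$$ In particular, on a pseudoconvex domain the Kobayashi pseudometric can be strictly greater than the weak derivative of the Lempert function. Moreover, if $t_j\in\mathbb C\setminus\{0\}$ and the complex $3\times 3$ matrices $C_j=(c^j_{k,l})$ satisfy $t_j\to0$, $C_j\to B$ and $$\liminf_{j\to\infty}\left|\frac{c^j_{3,2}}{t_j}-3\right|>0,$$ then $$\lim_{j\to\infty}\frac{l_{\Omega_3}(A,A+t_jC_j)}{|t_j|}=0.$$ -/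

import Mathlib

open Set Filter Topology
open scoped ENNReal

noncomputable section

section General

variable {E : Type*} [AddCommGroup E] [Module ℂ E] [TopologicalSpace E]

/-- `φ ∈ 𝒪(𝔻, D)`: the map `φ` is holomorphic on the open unit disc and sends it into `D`. -/
def IsHolomorphicDisc (D : Set E) (φ : ℂ → E) : Prop :=
  DifferentiableOn ℂ φ (Metric.ball 0 1) ∧ MapsTo φ (Metric.ball 0 1) D

/-- The Lempert function
`l_D(z, w) = inf {|α| : α ∈ 𝔻, ∃ φ ∈ 𝒪(𝔻, D), φ(0) = z, φ(α) = w}`,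
as an extended nonnegative real (it is `⊤` only if no disc in `D` joins `z` to `w`). -/
def lempertFunction (D : Set E) (z w : E) : ℝ≥0∞ :=
  sInf {x | ∃ α ∈ Metric.ball (0 : ℂ) 1, ∃ φ : ℂ → E,
    IsHolomorphicDisc D φ ∧ φ 0 = z ∧ φ α = w ∧ x = ‖α‖ₑ}

/-- The weak derivative of the Lempert function,
`limsup_{t → 0, t ≠ 0} l_D(z, z + tX) / |t|`, where `t` is complex. -/
def weakDerivLempert (D : Set E) (z X : E) : ℝ≥0∞ :=
  limsup (fun t : ℂ => lempertFunction D z (z + t • X) / ‖t‖ₑ) (𝓝[≠] 0)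

/-- The Kobayashi pseudometric
`κ_D(z; X) = inf {|α| : α ∈ ℂ, ∃ φ ∈ 𝒪(𝔻, D), φ(0) = z, α φ'(0) = X}`,
as an extended nonnegative real. -/
def kobayashiMetric [ContinuousSMul ℂ E] (D : Set E) (z X : E) : ℝ≥0∞ :=
  sInf {x | ∃ α : ℂ, ∃ φ : ℂ → E,
    IsHolomorphicDisc D φ ∧ φ 0 = z ∧ α • deriv φ 0 = X ∧ x = ‖α‖ₑ}

/-- A continuous function `u` on the open set `D` is plurisubharmonic: on every closed complex
disc `{a + ζ b : |ζ| ≤ 1}` contained in `D`, the value of `u` at the centre is at most its mean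
over the boundary circle. -/
def IsContinuousPSH (D : Set E) (u : E → ℝ) : Prop :=
  ContinuousOn u D ∧
    ∀ a b : E, (∀ ζ ∈ Metric.closedBall (0 : ℂ) 1, a + ζ • b ∈ D) →
      u a ≤ Real.circleAverage (fun ζ : ℂ => u (a + ζ • b)) 0 1

/-- A pseudoconvex domain: a nonempty connected open set that has a continuous plurisubharmonic
exhaustion function. -/
def IsPseudoconvexDomain (D : Set E) : Prop :=
  IsOpen D ∧ IsConnected D ∧
    ∃ u : E → ℝ, IsContinuousPSH D u ∧ ∀ c : ℝ, IsCompact {z | z ∈ D ∧ u z ≤ c}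

end General

/-- The spectral ball `Ω_n`: complex `n × n` matrices of spectral radius less than one. -/
def spectralBall (n : ℕ) : Set (Matrix (Fin n) (Fin n) ℂ) :=
  {M | spectralRadius ℂ M < 1}

/-- `ω = e^{2πi/3}`. -/
def omega : ℂ := Complex.exp (2 * Real.pi * Complex.I / 3)

def matA : Matrix (Fin 3) (Fin 3) ℂ :=
  !![0, 0, 0;
     0, 0, 1;
     0, 0, 0]

def matB : Matrix (Fin 3) (Fin 3) ℂ :=
  !![1, 0, 0;
     0, omega, 0;
     0, 0, omega ^ 2]

end

/-! Pseudoconvexity: each `M ^ k` is holomorphic in `M`, so `∑' k, ‖M ^ k‖` is plurisubharmonic. It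
is continuous on the spectral ball and exhausts it.

Kobayashi metric: along a disc through A with velocity βB, the sum of principal minors is divisible
by ζ² and the determinant by ζ³. Both stay bounded by 3, so the maximum principle bounds the leading
coefficients -h(0) and β³ - βh(0), where h(0) is the ζ² coefficient of the (3,2) entry. Hence |β| ≤
3 (`norm_le_three_of_deriv_eq`).

Lempert function: a disc from A to W = A + tC has no prescribed velocity. If W has a cyclic vector,
it is similar to its companion matrix, which a polynomial family with determinant only quadratic in
the parameter joins to A. Conjugating by an entire curve of invertible matrices makes this family
end at W without changing spectra (`lempertFunction_matA_le`). As C → B, the trace and sum of minors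
of W are o(t) and the determinant is o(t²), so α = et is admissible for every e > 0 once t is small.
A cyclic vector exists when c₃₂/t stays away from 3 (`exists_det_krylov_ne_zero`). -/

/-! ### Power sums of norms and the plurisubharmonic exhaustion -/

section NormPowers

variable {R : Type*} [NormedRing R] [NormOneClass R]

/-- If some power of `M` is small, the powers of all matrices near `M` are summably bounded. -/
theorem exists_summable_bound_norm_pow {M : R} {N : ℕ} (hN : ‖M ^ (N + 1)‖ < 1) :
    ∃ U : Set R, IsOpen U ∧ M ∈ U ∧ ∃ b : ℕ → ℝ, Summable b ∧ ∀ X ∈ U, ∀ k, ‖X ^ k‖ ≤ b k := by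
  obtain ⟨r, hr, hr1⟩ := exists_between hN
  have hr0 : 0 < r := (norm_nonneg _).trans_lt hr
  set q : ℝ := r ^ (((N + 1 : ℕ) : ℝ)⁻¹) with hq
  have hqN : q ^ (N + 1) = r := Real.rpow_inv_natCast_pow hr0.le (Nat.succ_ne_zero N)
  have hq0 : 0 < q := Real.rpow_pos_of_pos hr0 _
  have hq1 : q < 1 := Real.rpow_lt_one hr0.le hr1 (by positivity)
  set K : ℝ := ‖M‖ + 1
  have hK : 1 ≤ K := by simp [K]
  refine ⟨{X | ‖X ^ (N + 1)‖ < r} ∩ {X | ‖X‖ < K}, ?_, ⟨hr, by simp [K]⟩,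
    fun k => (K ^ (N + 1) / r) * q ^ k,
    (summable_geometric_of_lt_one hq0.le hq1).mul_left _, ?_⟩
  · exact (isOpen_lt (by fun_prop) continuous_const).inter
      (isOpen_lt (by fun_prop) continuous_const)
  rintro X ⟨hX1, hX2⟩ k
  simp only [mem_ofPred_eq] at hX1 hX2
  have hdiv := Nat.div_add_mod k (N + 1)
  have hmod : k % (N + 1) < N + 1 := Nat.mod_lt _ (Nat.succ_pos N)
  have h1 : ‖X ^ k‖ ≤ r ^ (k / (N + 1)) * K ^ (N + 1) := by
    calc ‖X ^ k‖ = ‖(X ^ (N + 1)) ^ (k / (N + 1)) * X ^ (k % (N + 1))‖ := by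
          rw [← pow_mul, ← pow_add, hdiv]
      _ ≤ ‖(X ^ (N + 1))‖ ^ (k / (N + 1)) * ‖X‖ ^ (k % (N + 1)) :=
          (norm_mul_le _ _).trans (mul_le_mul (norm_pow_le _ _) (norm_pow_le _ _)
            (norm_nonneg _) (by positivity))
      _ ≤ r ^ (k / (N + 1)) * K ^ (k % (N + 1)) := by gcongr
      _ ≤ r ^ (k / (N + 1)) * K ^ (N + 1) := by gcongr
  -- The extra factor `r` absorbs the rounding in `k / (N + 1)`, since `(N + 1) * (k / (N + 1) + 1)
  -- ≥ k`.
  have h2 : r ^ (k / (N + 1)) * r ≤ q ^ k := by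
    rw [← pow_succ, ← hqN, ← pow_mul]
    refine pow_le_pow_of_le_one hq0.le hq1.le ?_
    rw [mul_add]
    omega
  calc ‖X ^ k‖ ≤ r ^ (k / (N + 1)) * K ^ (N + 1) := h1
    _ = K ^ (N + 1) / r * (r ^ (k / (N + 1)) * r) := by field_simp
    _ ≤ K ^ (N + 1) / r * q ^ k := by gcongr

theorem summable_norm_pow {M : R} {N : ℕ} (hN : ‖M ^ (N + 1)‖ < 1) :
    Summable fun k => ‖M ^ k‖ := by
  obtain ⟨U, -, hM, b, hb, hU⟩ := exists_summable_bound_norm_pow hN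
  exact hb.of_nonneg_of_le (fun _ => norm_nonneg _) (hU M hM)

theorem continuousOn_tsum_norm_pow :
    ContinuousOn (fun M : R => ∑' k, ‖M ^ k‖) {M | ∃ N, ‖M ^ (N + 1)‖ < 1} := by
  rintro M ⟨N, hN⟩
  obtain ⟨U, hUo, hM, b, hb, hU⟩ := exists_summable_bound_norm_pow hN
  have : ContinuousOn (fun M : R => ∑' k, ‖M ^ k‖) U :=
    continuousOn_tsum (fun k => by fun_prop) hb fun k X hX => by simpa using hU X hX k
  exact (this.continuousAt (hUo.mem_nhds hM)).continuousWithinAt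

/-- Bounded partial sums force ‖M ^ k‖ → 0, so membership in the domain is automatic. The sublevel
set is therefore closed in the whole space. -/
theorem setOf_tsum_norm_pow_le (c : ℝ) :
    {M : R | (∃ N, ‖M ^ (N + 1)‖ < 1) ∧ ∑' k, ‖M ^ k‖ ≤ c} =
      ⋂ n : ℕ, {M : R | ∑ k ∈ Finset.range n, ‖M ^ k‖ ≤ c} := by
  ext M
  simp only [mem_ofPred_eq, mem_iInter]
  constructor
  · rintro ⟨⟨N, hN⟩, h⟩ n
    exact ((summable_norm_pow hN).sum_le_tsum _ fun _ _ => norm_nonneg _).trans h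
  · intro h
    have hs : Summable fun k => ‖M ^ k‖ := summable_of_sum_range_le (fun _ => norm_nonneg _) h
    refine ⟨?_, Real.tsum_le_of_sum_range_le (fun _ => norm_nonneg _) h⟩
    have h0 := (tendsto_add_atTop_iff_nat 1).2 hs.tendsto_atTop_zero
    exact (h0.eventually_lt_const one_pos).exists

theorem isCompact_setOf_tsum_norm_pow_le [ProperSpace R] (c : ℝ) :
    IsCompact {M : R | (∃ N, ‖M ^ (N + 1)‖ < 1) ∧ ∑' k, ‖M ^ k‖ ≤ c} := by
  rw [setOf_tsum_norm_pow_le]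
  refine Metric.isCompact_of_isClosed_isBounded
    (isClosed_iInter fun n => isClosed_le (by fun_prop) continuous_const) ?_
  refine (Metric.isBounded_closedBall (x := (0 : R)) (r := c)).subset fun M hM => ?_
  -- The first two terms give 1 + ‖M‖ ≤ c.
  have := mem_iInter.1 hM 2
  simp only [Finset.sum_range_succ, Finset.sum_range_zero, mem_ofPred_eq, pow_zero, norm_one,
    pow_one] at this
  simp only [Metric.mem_closedBall, dist_zero_right]
  linarith

end NormPowers

theorem norm_circleAverage_le_circleAverage_norm {E : Type*} [NormedAddCommGroup E]
    [NormedSpace ℝ E] (f : ℂ → E) (c : ℂ) (r : ℝ) :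
    ‖Real.circleAverage f c r‖ ≤ Real.circleAverage (fun z => ‖f z‖) c r := by
  rw [Real.circleAverage, Real.circleAverage, norm_smul, Real.norm_of_nonneg (by positivity),
    smul_eq_mul]
  gcongr
  exact intervalIntegral.norm_integral_le_integral_norm Real.two_pi_pos.le

theorem norm_le_circleAverage_norm_of_differentiable {E : Type*} [NormedAddCommGroup E]
    [NormedSpace ℂ E] [CompleteSpace E] {f : ℂ → E} (hf : Differentiable ℂ f) (c : ℂ) (r : ℝ) :
    ‖f c‖ ≤ Real.circleAverage (fun z => ‖f z‖) c r := by
  rw [← (hf.diffContOnCl (s := Metric.ball c |r|)).circleAverage]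
  exact norm_circleAverage_le_circleAverage_norm f c r

theorem tsum_norm_pow_le_circleAverage {R : Type*} [NormedRing R] [NormOneClass R]
    [NormedAlgebra ℂ R] [CompleteSpace R] (a b : R)
    (h : ∀ ζ ∈ Metric.closedBall (0 : ℂ) 1, ∃ N, ‖(a + ζ • b) ^ (N + 1)‖ < 1) :
    ∑' k, ‖a ^ k‖ ≤ Real.circleAverage (fun ζ : ℂ => ∑' k, ‖(a + ζ • b) ^ k‖) 0 1 := by
  refine Real.tsum_le_of_sum_range_le (fun _ => norm_nonneg _) fun n => ?_
  have hint : ∀ k, CircleIntegrable (fun ζ : ℂ => ‖(a + ζ • b) ^ k‖) 0 1 := fun k =>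
    ContinuousOn.circleIntegrable zero_le_one (by fun_prop)
  have h1 : ∀ k, ‖a ^ k‖ ≤ Real.circleAverage (fun ζ : ℂ => ‖(a + ζ • b) ^ k‖) 0 1 := fun k => by
    have := norm_le_circleAverage_norm_of_differentiable
      (f := fun ζ : ℂ => (a + ζ • b) ^ k) (by fun_prop) 0 1
    simpa using this
  calc ∑ k ∈ Finset.range n, ‖a ^ k‖
      ≤ ∑ k ∈ Finset.range n, Real.circleAverage (fun ζ : ℂ => ‖(a + ζ • b) ^ k‖) 0 1 :=
        Finset.sum_le_sum fun k _ => h1 k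
    _ = Real.circleAverage (fun ζ : ℂ => ∑ k ∈ Finset.range n, ‖(a + ζ • b) ^ k‖) 0 1 :=
        (Real.circleAverage_fun_sum fun k _ => hint k).symm
    _ ≤ _ := by
        refine Real.circleAverage_mono
          (ContinuousOn.circleIntegrable zero_le_one (by fun_prop))
          (ContinuousOn.circleIntegrable zero_le_one ?_) fun ζ hζ => ?_
        · exact continuousOn_tsum_norm_pow.comp (by fun_prop)
            fun ζ hζ => h ζ (Metric.sphere_subset_closedBall hζ)
        · obtain ⟨N, hN⟩ := h ζ (Metric.sphere_subset_closedBall (by simpa using hζ))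
          exact (summable_norm_pow hN).sum_le_tsum _ fun _ _ => norm_nonneg _

theorem spectralRadius_lt_one_iff_exists_norm_pow {R : Type*} [NormedRing R] [NormOneClass R]
    [NormedAlgebra ℂ R] [CompleteSpace R] {M : R} :
    spectralRadius ℂ M < 1 ↔ ∃ N, ‖M ^ (N + 1)‖ < 1 := by
  constructor
  · intro h
    have h1 := (spectrum.pow_nnnorm_pow_one_div_tendsto_nhds_spectralRadius M).eventually_lt_const h
    obtain ⟨n, hn, hn0⟩ := (h1.and (eventually_gt_atTop 0)).exists
    obtain ⟨N, rfl⟩ := Nat.exists_eq_succ_of_ne_zero hn0.ne'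
    refine ⟨N, ?_⟩
    by_contra! hc
    refine hn.not_ge (ENNReal.one_le_rpow ?_ (by positivity))
    exact_mod_cast hc
  · rintro ⟨N, hN⟩
    refine (spectrum.spectralRadius_le_pow_nnnorm_pow_one_div ℂ M N).trans_lt ?_
    rw [nnnorm_one, ENNReal.coe_one, ENNReal.one_rpow, mul_one]
    refine ENNReal.rpow_lt_one ?_ (by positivity)
    exact_mod_cast hN

section

attribute [local instance] Matrix.linftyOpNormedRing Matrix.linftyOpNormedAlgebra

theorem spectralBall_eq_setOf_exists_norm_pow (n : ℕ) [NeZero n] :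
    spectralBall n = {M | ∃ N, ‖M ^ (N + 1)‖ < 1} := by
  ext M
  exact spectralRadius_lt_one_iff_exists_norm_pow

theorem isPseudoconvexDomain_spectralBall (n : ℕ) [NeZero n] :
    IsPseudoconvexDomain (spectralBall n) := by
  have hp : ProperSpace (Matrix (Fin n) (Fin n) ℂ) := FiniteDimensional.proper ℂ _
  rw [spectralBall_eq_setOf_exists_norm_pow]
  refine ⟨?_, ?_, fun M => ∑' k, ‖M ^ k‖, ⟨continuousOn_tsum_norm_pow, fun a b h => ?_⟩, fun c => ?_⟩
  · rw [ofPred_exists]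
    exact isOpen_iUnion fun N => isOpen_lt (by fun_prop) continuous_const
  · have hs : StarConvex ℝ (0 : Matrix (Fin n) (Fin n) ℂ) {M | ∃ N, ‖M ^ (N + 1)‖ < 1} := by
      rw [starConvex_zero_iff]
      rintro M ⟨N, hN⟩ r hr0 hr1
      refine ⟨N, ?_⟩
      rw [show r • M = (r : ℂ) • M by ext; simp, smul_pow, norm_smul, norm_pow,
        Complex.norm_real, Real.norm_of_nonneg hr0]
      exact (mul_le_of_le_one_left (norm_nonneg _) (pow_le_one₀ hr0 hr1)).trans_lt hN
    exact (hs.isPathConnected ⟨0, by simp⟩).isConnected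
  · exact tsum_norm_pow_le_circleAverage a b h
  · exact isCompact_setOf_tsum_norm_pow_le c

end

/-! ### Characteristic coefficients of 3 × 3 matrices in the spectral ball -/

theorem mem_spectralBall_iff_forall_isRoot {n : ℕ} [NeZero n] {M : Matrix (Fin n) (Fin n) ℂ} :
    M ∈ spectralBall n ↔ ∀ z, M.charpoly.IsRoot z → ‖z‖ < 1 := by
  simp_rw [← Matrix.mem_spectrum_iff_isRoot_charpoly]
  let _ := Matrix.linftyOpNormedRing (n := Fin n) (α := ℂ)
  let _ := Matrix.linftyOpNormedAlgebra (R := ℂ) (n := Fin n) (α := ℂ)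
  constructor
  · intro h z hz
    have h1 : (‖z‖₊ : ℝ≥0∞) ≤ spectralRadius ℂ M := le_iSup₂ (f := fun z _ => (‖z‖₊ : ℝ≥0∞)) z hz
    exact_mod_cast h1.trans_lt h
  · intro h
    exact_mod_cast spectrum.spectralRadius_lt_of_forall_lt (r := 1) M fun z hz => h z hz

/-- The second elementary symmetric function of the eigenvalues of a `3 × 3` matrix. -/
def sumMinors {R : Type*} [CommRing R] (M : Matrix (Fin 3) (Fin 3) R) : R :=
  M 0 0 * M 1 1 + M 0 0 * M 2 2 + M 1 1 * M 2 2 - M 0 1 * M 1 0 - M 0 2 * M 2 0 - M 1 2 * M 2 1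

theorem eval_charpoly_fin_three (M : Matrix (Fin 3) (Fin 3) ℂ) (z : ℂ) :
    M.charpoly.eval z = z ^ 3 - M.trace * z ^ 2 + sumMinors M * z - M.det := by
  simp only [Matrix.eval_charpoly, Matrix.det_fin_three, Matrix.trace_fin_three, sumMinors,
    Matrix.sub_apply, Matrix.scalar_apply, Matrix.diagonal_apply]
  simp
  ring

theorem charpoly_fin_three (M : Matrix (Fin 3) (Fin 3) ℂ) :
    M.charpoly = .X ^ 3 - .C M.trace * .X ^ 2 + .C (sumMinors M) * .X - .C M.det :=
  Polynomial.funext fun z => by simp [eval_charpoly_fin_three]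

theorem norm_coeff_charpoly_le {M : Matrix (Fin 3) (Fin 3) ℂ} (hM : M ∈ spectralBall 3) (i : ℕ) :
    ‖M.charpoly.coeff i‖ ≤ 3 := by
  rw [mem_spectralBall_iff_forall_isRoot] at hM
  have h := Polynomial.coeff_bdd_of_roots_le (B := 1) (d := 3) (RingHom.id ℂ) M.charpoly_monic
    (IsAlgClosed.splits _) (by simp [Matrix.charpoly_natDegree_eq_dim])
    (fun z hz => (hM z (by simpa using Polynomial.isRoot_of_mem_roots hz)).le) i
  simpa using h

theorem norm_sumMinors_le {M : Matrix (Fin 3) (Fin 3) ℂ} (hM : M ∈ spectralBall 3) :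
    ‖sumMinors M‖ ≤ 3 := by
  simpa [charpoly_fin_three, Polynomial.coeff_X, Polynomial.coeff_C] using
    norm_coeff_charpoly_le hM 1

theorem norm_det_le {M : Matrix (Fin 3) (Fin 3) ℂ} (hM : M ∈ spectralBall 3) : ‖M.det‖ ≤ 3 := by
  simpa [charpoly_fin_three, Polynomial.coeff_X, Polynomial.coeff_C] using
    norm_coeff_charpoly_le hM 0

/-- A root with |z| ≥ 1 would satisfy |z|³ ≤ (sum of coefficient norms)·|z|² < |z|². -/
theorem mem_spectralBall_of_norm_add_lt {M : Matrix (Fin 3) (Fin 3) ℂ}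
    (h : ‖M.trace‖ + ‖sumMinors M‖ + ‖M.det‖ < 1) : M ∈ spectralBall 3 := by
  rw [mem_spectralBall_iff_forall_isRoot]
  intro z hz
  by_contra! hz1
  rw [Polynomial.IsRoot, eval_charpoly_fin_three] at hz
  have h1 : z ^ 3 = M.trace * z ^ 2 - sumMinors M * z + M.det := by linear_combination hz
  have h2 : ‖z‖ ^ 3 ≤ ‖M.trace‖ * ‖z‖ ^ 2 + ‖sumMinors M‖ * ‖z‖ + ‖M.det‖ := by
    rw [← norm_pow, h1]
    refine (norm_add_le _ _).trans (add_le_add_left ((norm_sub_le _ _).trans ?_) _)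
    simp [norm_pow]
  have h3 : ‖sumMinors M‖ * ‖z‖ ≤ ‖sumMinors M‖ * ‖z‖ ^ 2 := by gcongr; nlinarith
  have h4 : ‖M.det‖ ≤ ‖M.det‖ * ‖z‖ ^ 2 := le_mul_of_one_le_right (norm_nonneg _) (by nlinarith)
  nlinarith [mul_pos (sub_pos.2 h) (show 0 < ‖z‖ ^ 2 by positivity)]

/-! ### Bounds for the Kobayashi metric -/

/-- A holomorphic function `H` with `ζ ^ k * H ζ` bounded by `C` on the unit disc has
`‖H 0‖ ≤ C`. -/
theorem norm_apply_zero_le_of_norm_pow_mul_le {H : ℂ → ℂ} {C : ℝ} (k : ℕ)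
    (hH : DifferentiableOn ℂ H (Metric.ball 0 1))
    (h : ∀ ζ ∈ Metric.ball (0 : ℂ) 1, ‖ζ ^ k * H ζ‖ ≤ C) : ‖H 0‖ ≤ C := by
  have key : ∀ r ∈ Ioo (0 : ℝ) 1, r ^ k * ‖H 0‖ ≤ C := by
    rintro r ⟨hr0, hr1⟩
    have hd : DiffContOnCl ℂ H (Metric.ball 0 r) := by
      refine DifferentiableOn.diffContOnCl (hH.mono ?_)
      exact Metric.closure_ball_subset_closedBall.trans (Metric.closedBall_subset_ball hr1)
    have := Complex.norm_le_of_forall_mem_frontier_norm_le (C := C / r ^ k)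
      Metric.isBounded_ball hd (fun z hz => ?_) (subset_closure (Metric.mem_ball_self hr0))
    · rw [le_div_iff₀ (by positivity)] at this
      linarith
    · rw [frontier_ball _ hr0.ne', mem_sphere_zero_iff_norm] at hz
      have h1 := h z (by simpa [hz] using hr1)
      rw [norm_mul, norm_pow, hz] at h1
      rw [le_div_iff₀ (by positivity)]
      linarith
  have hlim : Tendsto (fun r : ℝ => r ^ k * ‖H 0‖) (𝓝[<] 1) (𝓝 (1 ^ k * ‖H 0‖)) :=
    (Continuous.tendsto (by fun_prop) _).mono_left nhdsWithin_le_nhds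
  rw [one_pow, one_mul] at hlim
  exact le_of_tendsto hlim (by filter_upwards [Ioo_mem_nhdsLT one_pos] using key)

theorem omega_isPrimitiveRoot : IsPrimitiveRoot omega 3 := by
  simpa [omega] using Complex.isPrimitiveRoot_exp 3 (by norm_num)

theorem one_add_omega_add_sq : 1 + omega + omega ^ 2 = 0 := by
  have := omega_isPrimitiveRoot.geom_sum_eq_zero (by norm_num)
  simpa [Finset.sum_range_succ] using this

theorem omega_pow_three : omega ^ 3 = 1 := omega_isPrimitiveRoot.pow_eq_one

theorem norm_omega : ‖omega‖ = 1 := omega_isPrimitiveRoot.norm'_eq_one (by norm_num)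

theorem hasDerivAt_matrix_of_differentiableAt {m n : Type*} [Fintype m] [Fintype n]
    {φ : ℂ → Matrix m n ℂ} {z : ℂ} (h : DifferentiableAt ℂ φ z) : HasDerivAt φ (deriv φ z) z := by
  let _ := Matrix.linftyOpNormedAddCommGroup (m := m) (n := n) (α := ℂ)
  let _ := Matrix.linftyOpNormedSpace (m := m) (n := n) (α := ℂ) (R := ℂ)
  exact h.hasDerivAt

theorem deriv_matrix_eq_of_hasDerivAt {m n : Type*} [Fintype m] [Fintype n]
    {φ : ℂ → Matrix m n ℂ} {φ' : Matrix m n ℂ} {z : ℂ} (h : HasDerivAt φ φ' z) :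
    deriv φ z = φ' := by
  let _ := Matrix.linftyOpNormedAddCommGroup (m := m) (n := n) (α := ℂ)
  let _ := Matrix.linftyOpNormedSpace (m := m) (n := n) (α := ℂ) (R := ℂ)
  exact h.deriv

theorem differentiable_matrix_iff {m n : Type*} [Fintype m] [Fintype n]
    {φ : ℂ → Matrix m n ℂ} : Differentiable ℂ φ ↔ ∀ i j, Differentiable ℂ fun ζ => φ ζ i j :=
  differentiable_pi.trans (forall_congr' fun _ => differentiable_pi)

/-- A holomorphic matrix-valued disc through `matA` with velocity `β • matB` in the spectral ball
satisfies `‖β‖ ≤ 3`. -/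
theorem norm_le_three_of_deriv_eq {φ : ℂ → Matrix (Fin 3) (Fin 3) ℂ}
    (hφ : IsHolomorphicDisc (spectralBall 3) φ) (h0 : φ 0 = matA) {β : ℂ}
    (h1 : deriv φ 0 = β • matB) : ‖β‖ ≤ 3 := by
  have hball : Metric.ball (0 : ℂ) 1 ∈ 𝓝 0 := Metric.ball_mem_nhds 0 one_pos
  have hd : ∀ i j, DifferentiableOn ℂ (fun ζ => φ ζ i j) (Metric.ball 0 1) := by
    intro i j ζ hζ
    exact differentiableWithinAt_pi.1 (differentiableWithinAt_pi.1 (hφ.1 ζ hζ) i) j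
  have hderiv : ∀ i j, deriv (fun ζ => φ ζ i j) 0 = β * matB i j := by
    intro i j
    have h2 : HasDerivAt φ (β • matB) 0 :=
      h1 ▸ hasDerivAt_matrix_of_differentiableAt
      ((hφ.1 0 (Metric.mem_ball_self one_pos)).differentiableAt hball)
    exact (hasDerivAt_pi.1 (hasDerivAt_pi.1 h2 i) j).deriv
  set g : Fin 3 → Fin 3 → ℂ → ℂ := fun i j => dslope (fun ζ => φ ζ i j) 0 with hg
  have hgd : ∀ i j, DifferentiableOn ℂ (g i j) (Metric.ball 0 1) := fun i j =>
    (Complex.differentiableOn_dslope hball).2 (hd i j)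
  have hg0 : ∀ i j, g i j 0 = β * matB i j := fun i j => by
    rw [hg]; simp only [dslope_same, hderiv]
  have hexp : ∀ i j ζ, φ ζ i j = matA i j + ζ * g i j ζ := fun i j ζ => by
    have := sub_smul_dslope (fun ζ => φ ζ i j) 0 ζ
    simp only [sub_zero, smul_eq_mul, h0] at this
    rw [hg]; simp only [this]; ring
  -- `g 2 1` vanishes at 0 because `matB 2 1 = 0`, so a second factor ζ splits off.
  set h : ℂ → ℂ := dslope (g 2 1) 0 with hh
  have hhd : DifferentiableOn ℂ h (Metric.ball 0 1) :=
    (Complex.differentiableOn_dslope hball).2 (hgd 2 1)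
  have hexp2 : ∀ ζ, g 2 1 ζ = ζ * h ζ := fun ζ => by
    have := sub_smul_dslope (g 2 1) 0 ζ
    simp only [sub_zero, smul_eq_mul, hg0] at this
    rw [hh, this]; simp [matB]
  -- `H` is `sumMinors (φ ζ)` divided by ζ². Its value at 0 is `-h 0`, because the eigenvalues of
  -- `matB` have vanishing second symmetric function.
  have hb1 : ‖h 0‖ ≤ 3 := by
    have := norm_apply_zero_le_of_norm_pow_mul_le (C := 3) 2
      (H := fun ζ => g 0 0 ζ * g 1 1 ζ + g 0 0 ζ * g 2 2 ζ + g 1 1 ζ * g 2 2 ζ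
        - g 0 1 ζ * g 1 0 ζ - g 0 2 ζ * g 2 0 ζ - (1 + ζ * g 1 2 ζ) * h ζ)
      (by fun_prop) (fun ζ hζ => ?_)
    · have e : β * (β * omega) + β * (β * omega ^ 2) + β * omega * (β * omega ^ 2) = 0 := by
        linear_combination β ^ 2 * one_add_omega_add_sq + β ^ 2 * omega_pow_three
      simpa [hg0, matB, e] using this
    · refine le_of_eq_of_le ?_ (norm_sumMinors_le (hφ.2 hζ))
      congr 1
      simp only [sumMinors, hexp, hexp2]
      simp [matA]
      ring
  -- `H` is `(φ ζ).det` divided by ζ³. The term through the entry 1 of `matA` and `g 0 1`, `g 2 0`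
  -- has only ζ² in front, so the missing ζ is taken from `g 2 0`; it contributes nothing at 0 since
  -- `g 0 1 0 = 0`.
  have hb2 : ‖β ^ 3 - β * h 0‖ ≤ 3 := by
    have := norm_apply_zero_le_of_norm_pow_mul_le (C := 3) 3
      (H := fun ζ => g 0 0 ζ * g 1 1 ζ * g 2 2 ζ - g 0 0 ζ * (1 + ζ * g 1 2 ζ) * h ζ
        - g 0 1 ζ * g 1 0 ζ * g 2 2 ζ + g 0 1 ζ * ((1 + ζ * g 1 2 ζ) * dslope (g 2 0) 0 ζ)
        + ζ * g 0 2 ζ * g 1 0 ζ * h ζ - g 0 2 ζ * g 1 1 ζ * g 2 0 ζ)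
      (((((((((hgd 0 0).mul (hgd 1 1)).mul (hgd 2 2)).sub
        (((hgd 0 0).mul (by fun_prop)).mul hhd)).sub
        (((hgd 0 1).mul (hgd 1 0)).mul (hgd 2 2))).add
        ((hgd 0 1).mul ((by fun_prop : DifferentiableOn ℂ (fun ζ => 1 + ζ * g 1 2 ζ) _).mul
          ((Complex.differentiableOn_dslope hball).2 (hgd 2 0)))))).add (by fun_prop)).sub
        (by fun_prop)) (fun ζ hζ => ?_)
    · have e : β * (β * omega) * (β * omega ^ 2) = β ^ 3 := by
        linear_combination β ^ 3 * omega_pow_three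
      simpa [hg0, matB, e] using this
    · refine le_of_eq_of_le ?_ (norm_det_le (hφ.2 hζ))
      congr 1
      have h20 : g 2 0 ζ = ζ * dslope (g 2 0) 0 ζ := by
        have := sub_smul_dslope (g 2 0) 0 ζ
        simp only [sub_zero, smul_eq_mul, hg0] at this
        rw [this]; simp [matB]
      simp only [Matrix.det_fin_three, hexp, hexp2]
      simp [matA]
      linear_combination (-(ζ ^ 2 * g 0 1 ζ * (1 + ζ * g 1 2 ζ))) * h20
  by_contra! hβ
  have h3 : ‖β‖ ^ 3 ≤ 3 + ‖β‖ * 3 := by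
    calc ‖β‖ ^ 3 = ‖(β ^ 3 - β * h 0) + β * h 0‖ := by rw [sub_add_cancel, norm_pow]
      _ ≤ 3 + ‖β‖ * 3 := (norm_add_le _ _).trans (add_le_add hb2 (by rw [norm_mul]; gcongr))
  nlinarith [sq_nonneg (‖β‖ - 3)]

theorem kobayashiMetric_pos : 0 < kobayashiMetric (spectralBall 3) matA matB := by
  refine lt_of_lt_of_le (b := ‖(3 : ℂ)⁻¹‖ₑ) (by simp) (le_sInf ?_)
  rintro x ⟨α, φ, hφ, h0, h1, rfl⟩
  have hα : α ≠ 0 := by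
    rintro rfl
    rw [zero_smul] at h1
    simpa [matB] using congrFun (congrFun h1 0) 0
  have h2 := norm_le_three_of_deriv_eq hφ h0 (β := α⁻¹) (by rw [← h1, inv_smul_smul₀ hα])
  rw [enorm_le_iff_norm_le, norm_inv]
  rw [norm_inv] at h2
  simpa using inv_le_of_inv_le₀ (norm_pos_iff.2 hα) h2

theorem kobayashiMetric_ne_top : kobayashiMetric (spectralBall 3) matA matB ≠ ⊤ := by
  refine ne_top_of_le_ne_top ENNReal.one_ne_top (sInf_le ?_)
  -- The affine disc `matA + ζ • matB` has eigenvalues ζ, ζω, ζω², so it stays in the ball and is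
  -- admissible with α = 1.
  have hderiv : ∀ ζ : ℂ, HasDerivAt (fun ζ : ℂ => matA + ζ • matB) matB ζ := fun ζ => by
    refine hasDerivAt_pi.2 fun i => hasDerivAt_pi.2 fun j => ?_
    simpa using ((hasDerivAt_id ζ).mul_const (matB i j)).const_add (matA i j)
  refine ⟨1, fun ζ => matA + ζ • matB, ⟨Differentiable.differentiableOn <|
    differentiable_matrix_iff.2 fun i j => by
      simp only [Matrix.add_apply, Matrix.smul_apply]; fun_prop,
    fun ζ hζ => ?_⟩, by simp,
    by rw [deriv_matrix_eq_of_hasDerivAt (hderiv 0), one_smul], by simp⟩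
  rw [mem_spectralBall_iff_forall_isRoot]
  intro z hz
  rw [mem_ball_zero_iff] at hζ
  have h1 : (z - ζ) * (z - ζ * omega) * (z - ζ * omega ^ 2) = 0 := by
    rw [← hz.eq_zero, eval_charpoly_fin_three]
    simp [sumMinors, Matrix.det_fin_three, Matrix.trace_fin_three, matA, matB]
    ring
  rcases mul_eq_zero.1 h1 with h2 | h2
  · rcases mul_eq_zero.1 h2 with h3 | h3
    · rwa [sub_eq_zero.1 h3]
    · rwa [sub_eq_zero.1 h3, norm_mul, norm_omega, mul_one]
  · rwa [sub_eq_zero.1 h2, norm_mul, norm_pow, norm_omega, one_pow, mul_one]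

/-! ### Discs built from companion matrices -/

theorem Differentiable.matrix_mul {l m n : Type*} [Fintype l] [Fintype m] [Fintype n]
    {F : ℂ → Matrix l m ℂ} {G : ℂ → Matrix m n ℂ} (hF : Differentiable ℂ F)
    (hG : Differentiable ℂ G) : Differentiable ℂ fun z => F z * G z := by
  rw [differentiable_matrix_iff] at hF hG ⊢
  intro i j
  simp only [Matrix.mul_apply]
  exact Differentiable.fun_sum fun k _ => (hF i k).mul (hG k j)

/-- Every invertible matrix is joined to the identity by an entire curve of invertible
matrices. -/
theorem exists_entire_path_of_det_ne_zero {n : Type*} [Fintype n] [DecidableEq n]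
    (P : Matrix n n ℂ) (hP : P.det ≠ 0) :
    ∃ G H : ℂ → Matrix n n ℂ, Differentiable ℂ G ∧ Differentiable ℂ H ∧
      (∀ z, G z * H z = 1) ∧ G 0 = 1 ∧ G 1 = P := by
  -- Diagonal factors are joined to 1 by exponentials of logarithms, transvections by scaling their
  -- parameter.
  refine Matrix.diagonal_transvection_induction_of_det_ne_zero
    (fun P => ∃ G H : ℂ → Matrix n n ℂ, Differentiable ℂ G ∧ Differentiable ℂ H ∧
      (∀ z, G z * H z = 1) ∧ G 0 = 1 ∧ G 1 = P) P hP (fun D hD => ?_) (fun t => ?_)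
    (fun A B _ _ ihA ihB => ?_)
  · have hD' : ∀ i, D i ≠ 0 := by
      simpa [Matrix.det_diagonal, Finset.prod_ne_zero_iff] using hD
    refine ⟨fun z => Matrix.diagonal fun i => Complex.exp (z * Complex.log (D i)),
      fun z => Matrix.diagonal fun i => Complex.exp (-(z * Complex.log (D i))), ?_, ?_, ?_, ?_, ?_⟩
    · rw [differentiable_matrix_iff]
      intro i j
      by_cases hij : i = j
      · subst hij; simp only [Matrix.diagonal_apply_eq]; fun_prop
      · simp only [Matrix.diagonal_apply_ne _ hij]; fun_prop
    · rw [differentiable_matrix_iff]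
      intro i j
      by_cases hij : i = j
      · subst hij; simp only [Matrix.diagonal_apply_eq]; fun_prop
      · simp only [Matrix.diagonal_apply_ne _ hij]; fun_prop
    · intro z
      simp [Matrix.diagonal_mul_diagonal, ← Complex.exp_add]
    · simp
    · simp [Complex.exp_log (hD' _)]
  · refine ⟨fun z => Matrix.transvection t.i t.j (z * t.c),
      fun z => Matrix.transvection t.i t.j (-(z * t.c)), ?_, ?_, ?_, ?_, ?_⟩
    · rw [differentiable_matrix_iff]
      intro i j
      simp only [Matrix.transvection, Matrix.add_apply, Matrix.single_apply]
      split_ifs <;> fun_prop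
    · rw [differentiable_matrix_iff]
      intro i j
      simp only [Matrix.transvection, Matrix.add_apply, Matrix.single_apply]
      split_ifs <;> fun_prop
    · intro z
      simp [Matrix.transvection_mul_transvection_same _ _ t.hij]
    · simp
    · simp [Matrix.TransvectionStruct.toMatrix]
  · obtain ⟨G, H, hG, hH, hGH, hG0, hG1⟩ := ihA
    obtain ⟨G', H', hG', hH', hGH', hG0', hG1'⟩ := ihB
    refine ⟨fun z => G z * G' z, fun z => H' z * H z, hG.matrix_mul hG', hH'.matrix_mul hH,
      fun z => ?_, by simp [hG0, hG0'], by simp [hG1, hG1']⟩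
    rw [Matrix.mul_assoc, ← Matrix.mul_assoc (G' z), hGH', Matrix.one_mul, hGH]

/-- The matrix with rows `v`, `v W`, `v W ^ 2`. -/
def krylov {R : Type*} [CommRing R] (W : Matrix (Fin 3) (Fin 3) R) (v : Fin 3 → R) :
    Matrix (Fin 3) (Fin 3) R :=
  Matrix.of ![v, Matrix.vecMul v W, Matrix.vecMul (Matrix.vecMul v W) W]

/-- A family of matrices with value `matA` at `0` and a companion matrix at `1`. -/
def companionFamily {R : Type*} [CommRing R] (τ s d x : R) : Matrix (Fin 3) (Fin 3) R :=
  !![0, x, 0;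
     0, 0, 1;
     d * x, -(s * x), τ * x]

/-- The first two rows are shifts; the last is Cayley–Hamilton applied to `v W ^ 3`. -/
theorem krylov_mul {R : Type*} [CommRing R] (W : Matrix (Fin 3) (Fin 3) R) (v : Fin 3 → R) :
    krylov W v * W = companionFamily W.trace (sumMinors W) W.det 1 * krylov W v := by
  ext i j
  fin_cases i
  · simp [krylov, companionFamily, Matrix.mul_apply, Matrix.vecMul, dotProduct, Fin.sum_univ_three]
  · simp [krylov, companionFamily, Matrix.mul_apply, Matrix.vecMul, dotProduct, Fin.sum_univ_three]
    ring
  · fin_cases j <;>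
    · simp [krylov, companionFamily, Matrix.mul_apply, Matrix.vecMul, dotProduct,
        Fin.sum_univ_three, Matrix.det_fin_three, Matrix.trace_fin_three, sumMinors]
      ring

theorem companionFamily_mem_spectralBall {τ s d x : ℂ} (h : ‖τ * x‖ + ‖s * x‖ + ‖d * x ^ 2‖ < 1) :
    companionFamily τ s d x ∈ spectralBall 3 := by
  refine mem_spectralBall_of_norm_add_lt ?_
  have e1 : (companionFamily τ s d x).trace = τ * x := by
    simp [companionFamily, Matrix.trace_fin_three]
  have e2 : sumMinors (companionFamily τ s d x) = s * x := by
    simp [companionFamily, sumMinors]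
  have e3 : (companionFamily τ s d x).det = d * x ^ 2 := by
    simp [companionFamily, Matrix.det_fin_three]
    ring
  rwa [e1, e2, e3]

/-- If `W` has a cyclic vector and small characteristic coefficients, it is joined to `matA` by a
disc in the spectral ball. -/
theorem lempertFunction_matA_le {W : Matrix (Fin 3) (Fin 3) ℂ} {v : Fin 3 → ℂ}
    (hv : (krylov W v).det ≠ 0) {α : ℂ} (hα : α ≠ 0) (hα1 : ‖α‖ < 1)
    (h : ‖W.trace‖ / ‖α‖ + ‖sumMinors W‖ / ‖α‖ + ‖W.det‖ / ‖α‖ ^ 2 < 1) :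
    lempertFunction (spectralBall 3) matA W ≤ ‖α‖ₑ := by
  obtain ⟨G, H, hG, hH, hGH, hG0, hG1⟩ := exists_entire_path_of_det_ne_zero _ hv
  have hHG : ∀ z, H z * G z = 1 := fun z => mul_eq_one_comm.1 (hGH z)
  have hH0 : H 0 = 1 := by simpa [hG0] using hGH 0
  set N := companionFamily W.trace (sumMinors W) W.det with hN
  have hNd : Differentiable ℂ N := by
    rw [differentiable_matrix_iff]
    intro i j
    fin_cases i <;> fin_cases j <;> simp [hN, companionFamily] <;> fun_prop
  have hF : Differentiable ℂ fun z => H z * N z * G z := (hH.matrix_mul hNd).matrix_mul hG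
  -- The parameter is rescaled so that `N 1`, the companion matrix of `W`, is reached at α.
  -- Conjugation by `G` turns it into `W` there and is trivial at 0.
  refine sInf_le ⟨α, by simpa using hα1, fun ζ => H (ζ / α) * N (ζ / α) * G (ζ / α),
    ⟨?_, fun ζ hζ => ?_⟩, ?_, ?_, rfl⟩
  · rw [differentiable_matrix_iff] at hF
    refine Differentiable.differentiableOn (differentiable_matrix_iff.2 fun i j => ?_)
    exact (hF i j).comp (differentiable_id.div_const α)
  · have hmem : N (ζ / α) ∈ spectralBall 3 := by
      refine companionFamily_mem_spectralBall (lt_of_le_of_lt ?_ h)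
      rw [mem_ball_zero_iff] at hζ
      have hα' : 0 < ‖α‖ := norm_pos_iff.2 hα
      have h1 : ‖ζ / α‖ ≤ 1 / ‖α‖ := by rw [norm_div]; gcongr
      rw [norm_mul, norm_mul, norm_mul, norm_pow]
      calc _ ≤ ‖W.trace‖ * (1 / ‖α‖) + ‖sumMinors W‖ * (1 / ‖α‖)
            + ‖W.det‖ * (1 / ‖α‖) ^ 2 := by gcongr
        _ = _ := by ring
    rw [mem_spectralBall_iff_forall_isRoot] at hmem ⊢
    beta_reduce
    rwa [Matrix.mul_assoc, Matrix.charpoly_mul_comm, Matrix.mul_assoc, hGH, Matrix.mul_one]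
  · simp only [zero_div, hG0, hH0, Matrix.one_mul, Matrix.mul_one, hN]
    ext i j
    fin_cases i <;> fin_cases j <;> simp [companionFamily, matA]
  · simp only [div_self hα, Matrix.mul_assoc, hN]
    rw [hG1, ← krylov_mul, ← hG1, ← Matrix.mul_assoc, hHG, Matrix.one_mul]

/-! ### Cyclic vectors and the limit of the Lempert quotient -/

/-- The coefficient of `x * y ^ 2` in `det (krylov (matA + t • C) ![x, y, 0])` is
`t ^ 2 * cyclicCoeff t C - t * (1 + t * C 1 2) ^ 2 * C 2 1`. -/
def cyclicCoeff (t : ℂ) (C : Matrix (Fin 3) (Fin 3) ℂ) : ℂ :=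
  (C 1 1 - C 0 0) * (t * C 1 0 * C 0 2 + (1 + t * C 1 2) * (C 1 1 + C 2 2))
    - C 1 0 * (t * C 0 0 * C 0 2 + C 0 1 * (1 + t * C 1 2) + t * C 0 2 * C 2 2)
    + C 0 2 * (t * C 1 0 * C 0 0 + t * C 1 1 * C 1 0 + (1 + t * C 1 2) * C 2 0)
    + (1 + t * C 1 2) * (C 0 0 ^ 2 + C 0 2 * C 2 0 - C 1 1 ^ 2)

theorem exists_det_krylov_ne_zero {t : ℂ} {C : Matrix (Fin 3) (Fin 3) ℂ} (ht : t ≠ 0)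
    (hC : 1 + t * C 1 2 ≠ 0) (h : C 2 1 / t ≠ cyclicCoeff t C / (1 + t * C 1 2) ^ 2) :
    ∃ v, (krylov (matA + t • C) v).det ≠ 0 := by
  by_contra! hv
  have h1 := hv ![1, 1, 0]
  have h2 := hv ![1, -1, 0]
  have h3 := hv ![1, 0, 0]
  apply h
  rw [div_eq_div_iff ht (pow_ne_zero _ hC)]
  refine mul_left_cancel₀ ht ?_
  simp only [krylov, Matrix.det_fin_three, Matrix.vecMul, dotProduct, Fin.sum_univ_three,
    Matrix.of_apply, Matrix.cons_val, Matrix.add_apply, Matrix.smul_apply, smul_eq_mul,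
    matA] at h1 h2 h3
  simp only [cyclicCoeff]
  -- The determinant is a cubic form in (x, y); half the sum of its values at (1, ±1) minus its
  -- value at (1, 0) isolates the coefficient of `x * y ^ 2`.
  linear_combination -(1 / 2) * h1 - (1 / 2) * h2 + h3

theorem tendsto_lempertFunction_div {ι : Type*} {l : Filter ι} {t : ι → ℂ}
    {C : ι → Matrix (Fin 3) (Fin 3) ℂ} (ht0 : ∀ᶠ j in l, t j ≠ 0) (ht : Tendsto t l (𝓝 0))
    (hC : Tendsto C l (𝓝 matB)) {δ : ℝ≥0∞} (hδ : 0 < δ)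
    (h : ∀ᶠ j in l, δ ≤ ‖C j 2 1 / t j - 3‖ₑ) :
    Tendsto (fun j => lempertFunction (spectralBall 3) matA (matA + t j • C j) / ‖t j‖ₑ)
      l (𝓝 0) := by
  have hpair : Tendsto (fun j => (t j, C j)) l (𝓝 (0, matB)) := ht.prodMk_nhds hC
  have hlim : ∀ (f : ℂ × Matrix (Fin 3) (Fin 3) ℂ → ℂ) (a : ℂ), Continuous f → f (0, matB) = a →
      Tendsto (fun j => f (t j, C j)) l (𝓝 a) := fun f a hf ha =>
    ha ▸ (hf.tendsto _).comp hpair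
  have hm : Tendsto (fun j => 1 + t j * C j 1 2) l (𝓝 1) :=
    hlim (fun p => 1 + p.1 * p.2 1 2) 1 (by fun_prop) (by simp)
  -- The exceptional value 3 arises here: the limit is 2 - ω - ω².
  have hK : Tendsto (fun j => cyclicCoeff (t j) (C j)) l (𝓝 3) := by
    refine hlim (fun p => cyclicCoeff p.1 p.2) 3 (by unfold cyclicCoeff; fun_prop) ?_
    simp [cyclicCoeff, matB]
    linear_combination (-1 : ℂ) * one_add_omega_add_sq + omega_pow_three
  have hq : Tendsto (fun j => ‖cyclicCoeff (t j) (C j) / (1 + t j * C j 1 2) ^ 2 - 3‖ₑ) l (𝓝 0) := by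
    have := ((hK.div (hm.pow 2) (by simp)).sub_const 3).enorm
    simpa using this
  have htr : Tendsto (fun j => ‖(C j).trace‖) l (𝓝 0) := by
    have := hlim (fun p => p.2.trace) 0 (by fun_prop)
      (by simpa [matB, Matrix.trace_fin_three] using one_add_omega_add_sq)
    simpa using this.norm
  have hs : Tendsto (fun j => ‖t j * sumMinors (C j) - C j 2 1‖) l (𝓝 0) := by
    have := hlim (fun p => p.1 * sumMinors p.2 - p.2 2 1) 0 (by unfold sumMinors; fun_prop)
      (by simp [matB])
    simpa using this.norm
  have hd : Tendsto
      (fun j => ‖t j * (C j).det - (C j 0 0 * C j 2 1 - C j 0 1 * C j 2 0)‖) l (𝓝 0) := by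
    have := hlim (fun p => p.1 * p.2.det - (p.2 0 0 * p.2 2 1 - p.2 0 1 * p.2 2 0)) 0
      (by fun_prop) (by simp [matB])
    simpa using this.norm
  rw [ENNReal.tendsto_nhds_zero]
  intro ε hε
  obtain ⟨e, he0, heε⟩ : ∃ e : ℝ, 0 < e ∧ ENNReal.ofReal e ≤ ε := by
    obtain ⟨e, he, heε⟩ := ENNReal.lt_iff_exists_nnreal_btwn.1 hε
    exact ⟨e, by exact_mod_cast he, by simpa using heε.le⟩
  have hsmall : Tendsto (fun j => ‖(e : ℂ) * t j‖) l (𝓝 0) := by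
    simpa using (ht.const_mul (e : ℂ)).norm
  filter_upwards [ht0, h, hq.eventually_lt_const hδ, hm.eventually_ne one_ne_zero,
    htr.eventually_lt_const (show 0 < e / 3 by positivity),
    hs.eventually_lt_const (show 0 < e / 3 by positivity),
    hd.eventually_lt_const (show 0 < e ^ 2 / 3 by positivity),
    hsmall.eventually_lt_const one_pos] with j hj0 hj hjq hjm hjtr hjs hjd hj1
  have ht' : 0 < ‖t j‖ := norm_pos_iff.2 hj0
  obtain ⟨v, hv⟩ := exists_det_krylov_ne_zero hj0 hjm (fun heq => by
    rw [heq] at hj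
    exact hj.not_gt hjq)
  have key := lempertFunction_matA_le hv (α := (e : ℂ) * t j)
    (mul_ne_zero (by exact_mod_cast he0.ne') hj0) hj1 ?_
  · refine (ENNReal.div_le_of_le_mul ?_).trans heε
    refine key.trans_eq ?_
    rw [enorm_mul, ← ofReal_norm, Complex.norm_real, Real.norm_of_nonneg he0.le]
  · have e1 : (matA + t j • C j).trace = t j * (C j).trace := by
      simp [Matrix.trace_fin_three, matA, mul_add]
    have e2 : sumMinors (matA + t j • C j) = t j * (t j * sumMinors (C j) - C j 2 1) := by
      simp [sumMinors, matA]
      ring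
    have e3 : (matA + t j • C j).det =
        t j ^ 2 * (t j * (C j).det - (C j 0 0 * C j 2 1 - C j 0 1 * C j 2 0)) := by
      simp [Matrix.det_fin_three, matA]
      ring
    rw [e1, e2, e3, norm_mul, norm_mul, norm_mul, norm_mul, norm_pow, Complex.norm_real,
      Real.norm_of_nonneg he0.le, mul_pow, mul_comm e, mul_comm (e ^ 2),
      mul_div_mul_left _ _ ht'.ne', mul_div_mul_left _ _ ht'.ne',
      mul_div_mul_left _ _ (pow_pos ht' 2).ne']
    have b1 := (div_lt_iff₀ he0).2 (hjtr.trans_eq (show e / 3 = 1 / 3 * e by ring))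
    have b2 := (div_lt_iff₀ he0).2 (hjs.trans_eq (show e / 3 = 1 / 3 * e by ring))
    have b3 := (div_lt_iff₀ (pow_pos he0 2)).2
      (hjd.trans_eq (show e ^ 2 / 3 = 1 / 3 * e ^ 2 by ring))
    linarith

theorem mainTheorem11 :
    IsPseudoconvexDomain (spectralBall 3) ∧
    (0 < kobayashiMetric (spectralBall 3) matA matB ∧
      kobayashiMetric (spectralBall 3) matA matB ≠ ⊤) ∧
    weakDerivLempert (spectralBall 3) matA matB = 0 ∧
    ∀ (t : ℕ → ℂ) (C : ℕ → Matrix (Fin 3) (Fin 3) ℂ),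
      (∀ j, t j ≠ 0) →
      Tendsto t atTop (𝓝 0) →
      Tendsto C atTop (𝓝 matB) →
      0 < liminf (fun j => ‖C j 2 1 / t j - 3‖ₑ) atTop →
      Tendsto (fun j => lempertFunction (spectralBall 3) matA (matA + t j • C j) / ‖t j‖ₑ)
        atTop (𝓝 0) := by
  refine ⟨isPseudoconvexDomain_spectralBall 3, ⟨kobayashiMetric_pos, kobayashiMetric_ne_top⟩,
    ?_, fun t C ht0 ht hC h => ?_⟩
  -- For constant `C = matB` the (3,2) entry is 0, so the distance to 3 is constantly 3.
  · refine Tendsto.limsup_eq (tendsto_lempertFunction_div (C := fun _ => matB) self_mem_nhdsWithin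
      nhdsWithin_le_nhds tendsto_const_nhds (δ := ‖(3 : ℂ)‖ₑ) (by simp) ?_)
    exact Eventually.of_forall fun t => by simp [matB]
  · obtain ⟨δ, hδ, hδl⟩ := exists_between h
    exact tendsto_lempertFunction_div (Eventually.of_forall ht0) ht hC hδ
      ((eventually_lt_of_lt_liminf hδl).mono fun _ => le_of_lt)
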